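/- Let $J\subseteq\mathbb R$ be an interval with $0\in J$, and let $f$ be a real function that is operator convex on $J$, i.e. $f$ is continuous on $J$ and $$f((1-\lambda)A+\lambda B)\le(1-\lambda)f(A)+\lambda f(B)$$ for all $\lambda\in[0,1]$ and all bounded self-adjoint operators $A,B$ on a complex Hilbert space whose spectra are contained in $J$. Suppose that $f(0)\le 0$. Let $\mathscr A$ be a unital $C^*$-algebra and let $\mathscr X$ be a (right) Hilbert $C^*$-module over $\mathscr A$, i.e. a complex vector space and right $\mathscr A$-module with an $\mathscr A$-valued inner product $\langle\cdot,\cdot\rangle$ such that $\langle x,x\rangle\ge0$ with equality only for $x=0$, $\langle x,\lambda y+z\rangle=\lambda\langle x,y\rangle+\langle x,z\rangle$, $\langle x,ya\rangle=\langle x,y\rangle a$ and $\langle x,y\rangle^*=\langle y,x\rangle$, which is complete for the norm $\|x\|=\|\langle x,x\rangle\|^{1/2}$. Let $\mathcal L(\mathscr X)$ be the $C^*$-algebra of adjointable operators on $\mathscr X$, i.e. of the maps $T$ for which there is a map $T^*$ with $\langle Tx,y\rangle=\langle x,T^*y\rangle$ for all $x,y\in\mathscr X$. Theorem. Let $T\in\mathcal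 L(\mathscr X)$ be self-adjoint with spectrum contained in $J$. Then for every $x\in\mathscr X$ with $\|x\|\le1$ the element $\langle x,Tx\rangle$ of $\mathscr A$ is self-adjoint with spectrum contained in $J$, and $$f(\langle x,Tx\rangle)\le\langle x,f(T)x\rangle ,$$ where $f(\langle x,Tx\rangle)\in\mathscr A$ and $f(T)\in\mathcal L(\mathscr X)$ are given by the continuous functional calculus. -/

import Mathlib

open scoped MulOpposite

universe u v

/-! ### Operator convexity -/

/-- `f` is operator convex on `J`: it is continuous on `J`, and
`f ((1 - t) A + t B) ≤ (1 - t) f(A) + t f(B)` in the Loewner order for all `t ∈ [0, 1]` and all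
bounded self-adjoint operators `A`, `B` on a complex Hilbert space with spectra in `J`. -/
def OperatorConvexOn.{w} (J : Set ℝ) (f : ℝ → ℝ) : Prop :=
  ContinuousOn f J ∧
    ∀ (H : Type w) [NormedAddCommGroup H] [InnerProductSpace ℂ H] [CompleteSpace H]
      (A B : H →L[ℂ] H) (t : ℝ), IsSelfAdjoint A → IsSelfAdjoint B →
      spectrum ℝ A ⊆ J → spectrum ℝ B ⊆ J → 0 ≤ t → t ≤ 1 →
      cfc f ((1 - t) • A + t • B) ≤ (1 - t) • cfc f A + t • cfc f B

/-! ### Right Hilbert modules over a C⋆-algebra -/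

/-- A (right) pre-Hilbert C⋆-module over `A`: a complex vector space that is a right `A`-module
(`MulOpposite.op a • x` stands for `x a`), with an `A`-valued inner product that is linear in the
second variable, and with the norm `‖x‖ = ‖⟨x, x⟩‖ ^ (1/2)`. It is a Hilbert C⋆-module over `A` when
moreover `CompleteSpace E`. The identity `lam (x a) = x (lam a) = (lam x) a` follows from the
fields, see `RightPreHilbertModule.smul_op_smul`. -/
class RightPreHilbertModule (A E : Type*) [CStarAlgebra A] [PartialOrder A]
    [NormedAddCommGroup E] [NormedSpace ℂ E] [Module Aᵐᵒᵖ E] extends Inner A E where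
  inner_self_nonneg (x : E) : 0 ≤ inner x x
  inner_self_eq_zero (x : E) : inner x x = 0 ↔ x = 0
  inner_smul_add_right (x y z : E) (lam : ℂ) :
    inner x (lam • y + z) = lam • inner x y + inner x z
  inner_op_smul_right (x y : E) (a : A) : inner x (MulOpposite.op a • y) = inner x y * a
  star_inner (x y : E) : star (inner x y) = inner y x
  norm_eq_sqrt_norm_inner_self (x : E) : ‖x‖ = Real.sqrt ‖inner x x‖

namespace RightPreHilbertModule

variable {A E : Type*} [CStarAlgebra A] [PartialOrder A]
  [NormedAddCommGroup E] [NormedSpace ℂ E] [Module Aᵐᵒᵖ E] [RightPreHilbertModule A E]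

theorem inner_add_right (x y z : E) : inner A x (y + z) = inner A x y + inner A x z := by
  simpa using inner_smul_add_right (A := A) x y z 1

theorem inner_zero_right (x : E) : inner A x (0 : E) = 0 := by
  simpa using inner_add_right (A := A) x 0 0

theorem inner_smul_right (x y : E) (c : ℂ) : inner A x (c • y) = c • inner A x y := by
  simpa [inner_zero_right] using inner_smul_add_right (A := A) x y 0 c

theorem inner_sub_right (x y z : E) : inner A x (y - z) = inner A x y - inner A x z := by
  have h := inner_add_right (A := A) x (y - z) z
  rw [sub_add_cancel] at h
  exact eq_sub_of_add_eq h.symm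

theorem inner_zero_left (x : E) : inner A (0 : E) x = 0 := by
  rw [← star_inner, inner_zero_right, star_zero]

theorem inner_add_left (x y z : E) : inner A (x + y) z = inner A x z + inner A y z := by
  rw [← star_inner, inner_add_right, star_add, star_inner, star_inner]

theorem inner_sub_left (x y z : E) : inner A (x - y) z = inner A x z - inner A y z := by
  rw [← star_inner, inner_sub_right, star_sub, star_inner, star_inner]

theorem inner_smul_left (x y : E) (c : ℂ) : inner A (c • x) y = star c • inner A x y := by
  rw [← star_inner, inner_smul_right, star_smul, star_inner]

theorem inner_op_smul_left (x y : E) (a : A) :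
    inner A (MulOpposite.op a • x) y = star a * inner A x y := by
  rw [← star_inner, inner_op_smul_right, star_mul, star_inner]

variable (A) in
theorem norm_sq_eq (x : E) : ‖x‖ ^ 2 = ‖inner A x x‖ := by
  rw [norm_eq_sqrt_norm_inner_self (A := A) x, Real.sq_sqrt (norm_nonneg _)]

variable (A) in
/-- Nondegeneracy of the inner product. -/
theorem ext_inner_left {x y : E} (h : ∀ z : E, inner A z x = inner A z y) : x = y := by
  rw [← sub_eq_zero, ← inner_self_eq_zero (A := A), inner_sub_right, h, sub_self]

theorem smul_op_smul (x : E) (a : A) (lam : ℂ) :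
    lam • MulOpposite.op a • x = MulOpposite.op (lam • a) • x ∧
      lam • MulOpposite.op a • x = MulOpposite.op a • lam • x := by
  constructor <;> apply ext_inner_left A <;> intro z <;>
    simp only [inner_smul_right, inner_op_smul_right, mul_smul_comm, smul_mul_assoc]

variable [StarOrderedRing A]

/-- The Cauchy-Schwarz inequality. -/
theorem norm_inner_le (x y : E) : ‖inner A x y‖ ≤ ‖x‖ * ‖y‖ := by
  set a : A := inner A x y with ha
  have hya : inner A y x = star a := (star_inner x y).symm
  rcases eq_or_ne x 0 with rfl | hx
  · simp [ha, inner_zero_left]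
  have hpos : 0 < ‖x‖ ^ 2 := by positivity
  have key : ‖x‖ ^ 2 • (star a * a) ≤ ‖x‖ ^ 2 • (‖x‖ ^ 2 • inner A y y) := by
    have h0 := inner_self_nonneg (A := A)
      (MulOpposite.op a • x - ((‖x‖ ^ 2 : ℝ) : ℂ) • y)
    have hle : star a * inner A x x * a ≤ ‖x‖ ^ 2 • (star a * a) := by
      rw [norm_sq_eq A]
      exact CStarAlgebra.star_left_conjugate_le_norm_smul
        (hb := (IsSelfAdjoint.of_nonneg (inner_self_nonneg x)))
    have hexp : inner A (MulOpposite.op a • x - ((‖x‖ ^ 2 : ℝ) : ℂ) • y)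
        (MulOpposite.op a • x - ((‖x‖ ^ 2 : ℝ) : ℂ) • y) =
        star a * inner A x x * a - ‖x‖ ^ 2 • (star a * a) - ‖x‖ ^ 2 • (star a * a)
          + ‖x‖ ^ 2 • (‖x‖ ^ 2 • inner A y y) := by
      simp only [inner_sub_left, inner_sub_right, inner_op_smul_left, inner_op_smul_right,
        inner_smul_left, inner_smul_right, ← ha, hya, Complex.star_def, Complex.conj_ofReal,
        mul_assoc]
      simp only [Complex.coe_smul, smul_sub, sub_mul, smul_mul_assoc, mul_assoc]
      abel
    rw [hexp] at h0
    have h1 := h0.trans (add_le_add_left (sub_le_sub_right (sub_le_sub_right hle _) _) _)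
    rw [sub_self, zero_sub, neg_add_eq_sub, sub_nonneg] at h1
    exact h1
  have key' : star a * a ≤ ‖x‖ ^ 2 • inner A y y := (smul_le_smul_iff_of_pos_left hpos).1 key
  have h2 : ‖a‖ ^ 2 ≤ (‖x‖ * ‖y‖) ^ 2 := by
    calc ‖a‖ ^ 2 = ‖star a * a‖ := by rw [CStarRing.norm_star_mul_self, sq]
      _ ≤ ‖‖x‖ ^ 2 • inner A y y‖ :=
        CStarAlgebra.norm_le_norm_of_nonneg_of_le (star_mul_self_nonneg a) key'
      _ = (‖x‖ * ‖y‖) ^ 2 := by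
        rw [norm_smul, ← norm_sq_eq A y, Real.norm_of_nonneg hpos.le, mul_pow]
  exact (pow_le_pow_iff_left₀ (norm_nonneg _) (by positivity) two_ne_zero).1 h2

theorem continuous_inner_left (y : E) : Continuous fun x : E => inner A x y := by
  refine (LipschitzWith.of_dist_le_mul (K := ‖y‖₊) fun x z => ?_).continuous
  rw [dist_eq_norm, dist_eq_norm, ← inner_sub_left, mul_comm]
  exact norm_inner_le _ _

theorem continuous_inner_right (x : E) : Continuous fun y : E => inner A x y := by
  refine (LipschitzWith.of_dist_le_mul (K := ‖x‖₊) fun y z => ?_).continuous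
  rw [dist_eq_norm, dist_eq_norm, ← inner_sub_right]
  exact norm_inner_le _ _

/-! ### The C⋆-algebra of adjointable operators -/

/-- The algebra `L(E)` of adjointable operators on `E`: the maps `T` for which there is a map `S`
with `⟨T x, y⟩ = ⟨x, S y⟩` for all `x`, `y`. When `E` is complete, every such map is automatically
linear and bounded, see `exists_adjointable_eq`. -/
def adjointable (A E : Type*) [CStarAlgebra A] [PartialOrder A]
    [NormedAddCommGroup E] [NormedSpace ℂ E] [Module Aᵐᵒᵖ E] [RightPreHilbertModule A E] :
    Subalgebra ℂ (E →L[ℂ] E) where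
  carrier := {T | ∃ S : E → E, ∀ x y : E, inner A (T x) y = inner A x (S y)}
  mul_mem' := by
    rintro T₁ T₂ ⟨S₁, h₁⟩ ⟨S₂, h₂⟩
    exact ⟨S₂ ∘ S₁, fun x y => by simp [h₁, h₂]⟩
  add_mem' := by
    rintro T₁ T₂ ⟨S₁, h₁⟩ ⟨S₂, h₂⟩
    exact ⟨S₁ + S₂, fun x y => by simp [h₁, h₂, inner_add_left, inner_add_right]⟩
  algebraMap_mem' c :=
    ⟨fun y => star c • y, fun x y => by
      simp [Algebra.algebraMap_eq_smul_one, inner_smul_left, inner_smul_right]⟩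

/-- On a Hilbert C⋆-module, every map that has an adjoint is (the underlying map of) an element of
`adjointable A E`. -/
theorem exists_adjointable_eq [CompleteSpace E] (T S : E → E)
    (h : ∀ x y : E, inner A (T x) y = inner A x (S y)) :
    ∃ T' : adjointable A E, ∀ x, (T' : E →L[ℂ] E) x = T x := by
  have h' : ∀ x y : E, inner A y (T x) = inner A (S y) x := fun x y => by
    rw [← star_inner, h, star_inner]
  let L : E →ₗ[ℂ] E :=
    { toFun := T
      map_add' := fun x y => ext_inner_left A fun z => by
        rw [h', inner_add_right, inner_add_right, h', h']
      map_smul' := fun c x => ext_inner_left A fun z => by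
        rw [h', RingHom.id_apply, inner_smul_right, inner_smul_right, h'] }
  have hL : Continuous L := by
    refine LinearMap.continuous_of_seq_closed_graph L fun u x y hu hTu => ?_
    refine ext_inner_left A fun z => ?_
    refine tendsto_nhds_unique (((continuous_inner_right (A := A) z).tendsto y).comp hTu) ?_
    have h1 := ((continuous_inner_right (A := A) (S z)).tendsto x).comp hu
    have h2 : inner A z (L x) = inner A (S z) x := h' x z
    rw [h2]
    exact h1.congr fun n => (h' (u n) z).symm
  exact ⟨⟨⟨L, hL⟩, S, h⟩, fun _ => rfl⟩

/-- Every adjointable operator has an adjoint which is again a bounded adjointable operator. -/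
theorem exists_adjoint (T : adjointable A E) :
    ∃ S : adjointable A E, ∀ x y : E,
      inner A ((T : E →L[ℂ] E) x) y = inner A x ((S : E →L[ℂ] E) y) := by
  obtain ⟨T, S, h⟩ := T
  have h' : ∀ x y : E, inner A (S y) x = inner A y (T x) := fun x y => by
    rw [← star_inner, ← h, star_inner]
  let L : E →ₗ[ℂ] E :=
    { toFun := S
      map_add' := fun x y => ext_inner_left A fun z => by
        rw [← h, inner_add_right, inner_add_right, h, h]
      map_smul' := fun c x => ext_inner_left A fun z => by
        rw [← h, RingHom.id_apply, inner_smul_right, inner_smul_right, h] }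
  have hL : ∀ y, ‖L y‖ ≤ ‖T‖ * ‖y‖ := fun y => by
    change ‖S y‖ ≤ ‖T‖ * ‖y‖
    rcases eq_or_ne (S y) 0 with h0 | h0
    · rw [h0, norm_zero]; positivity
    · refine le_of_mul_le_mul_left ?_ (norm_pos_iff.2 h0)
      calc ‖S y‖ * ‖S y‖ = ‖inner A (T (S y)) y‖ := by rw [h, ← norm_sq_eq A, sq]
        _ ≤ ‖T (S y)‖ * ‖y‖ := norm_inner_le _ _
        _ ≤ ‖T‖ * ‖S y‖ * ‖y‖ := by gcongr; exact T.le_opNorm _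
        _ = ‖S y‖ * (‖T‖ * ‖y‖) := by ring
  exact ⟨⟨L.mkContinuous ‖T‖ hL, T, fun x y => h' y x⟩, h⟩

/-- The involution of `L(E)` is the adjoint. -/
noncomputable instance : Star (adjointable A E) where
  star T := (exists_adjoint T).choose

theorem inner_star_right (T : adjointable A E) (x y : E) :
    inner A x (((star T : adjointable A E) : E →L[ℂ] E) y) =
      inner A ((T : E →L[ℂ] E) x) y :=
  ((exists_adjoint T).choose_spec x y).symm

theorem adjointable_ext {S T : adjointable A E}
    (h : ∀ x y : E, inner A x ((S : E →L[ℂ] E) y) = inner A x ((T : E →L[ℂ] E) y)) : S = T :=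
  Subtype.ext <| ContinuousLinearMap.ext fun y => ext_inner_left A fun x => h x y

theorem inner_star_left (T : adjointable A E) (x y : E) :
    inner A (((star T : adjointable A E) : E →L[ℂ] E) x) y =
      inner A x ((T : E →L[ℂ] E) y) := by
  rw [← star_inner, inner_star_right, star_inner]

noncomputable instance : StarRing (adjointable A E) where
  star_involutive T := adjointable_ext fun x y => by rw [inner_star_right, inner_star_left]
  star_mul S T := adjointable_ext fun x y => by
    simp [inner_star_right]
  star_add S T := adjointable_ext fun x y => by
    simp [inner_star_right, inner_add_left, inner_add_right]

instance : StarModule ℂ (adjointable A E) where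
  star_smul c T := adjointable_ext fun x y => by
    simp [inner_star_right, inner_smul_left, inner_smul_right]

theorem norm_mul_self_le_adjointable (T : adjointable A E) : ‖T‖ * ‖T‖ ≤ ‖star T * T‖ := by
  have h : ‖(T : E →L[ℂ] E)‖ ≤ Real.sqrt ‖star T * T‖ := by
    refine ContinuousLinearMap.opNorm_le_bound _ (Real.sqrt_nonneg _) fun x => ?_
    refine (pow_le_pow_iff_left₀ (norm_nonneg _) (by positivity) two_ne_zero).1 ?_
    rw [mul_pow, Real.sq_sqrt (norm_nonneg (star T * T)), norm_sq_eq A, ← inner_star_right]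
    refine (norm_inner_le _ _).trans ?_
    have := ((star T * T : adjointable A E) : E →L[ℂ] E).le_opNorm x
    calc _ ≤ ‖x‖ * (‖star T * T‖ * ‖x‖) := by gcongr; exact this
      _ = _ := by ring
  calc ‖T‖ * ‖T‖ ≤ Real.sqrt ‖star T * T‖ * Real.sqrt ‖star T * T‖ := by gcongr <;> exact h
    _ = _ := Real.mul_self_sqrt (norm_nonneg _)

instance : CStarRing (adjointable A E) where
  norm_mul_self_le := norm_mul_self_le_adjointable

instance [CompleteSpace E] : CompleteSpace (adjointable A E) := by
  refine Metric.complete_of_cauchySeq_tendsto fun u hu => ?_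
  let _ : NonUnitalNormedRing (adjointable A E) := inferInstance
  have : NormedStarGroup (adjointable A E) := CStarRing.to_normedStarGroup
  have hiso : Isometry (star : adjointable A E → adjointable A E) := star_isometry
  have hv : CauchySeq fun n => ((star (u n) : adjointable A E) : E →L[ℂ] E) :=
    (hiso.uniformContinuous.comp_cauchySeq hu).map uniformContinuous_subtype_val
  have hu' : CauchySeq fun n => (u n : E →L[ℂ] E) := hu.map uniformContinuous_subtype_val
  obtain ⟨T, hT⟩ := cauchySeq_tendsto_of_complete hu'
  obtain ⟨S, hS⟩ := cauchySeq_tendsto_of_complete hv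
  have h : ∀ x y : E, inner A (T x) y = inner A x (S y) := fun x y => by
    have h1 := ((continuous_inner_left (A := A) y).tendsto _).comp
      (((ContinuousLinearMap.apply ℂ E x).continuous.tendsto T).comp hT)
    have h2 := ((continuous_inner_right (A := A) x).tendsto _).comp
      (((ContinuousLinearMap.apply ℂ E y).continuous.tendsto S).comp hS)
    exact tendsto_nhds_unique h1 (h2.congr fun n => inner_star_right (u n) x y)
  exact ⟨⟨T, S, h⟩, tendsto_subtype_rng.2 hT⟩

/-- The adjointable operators on a Hilbert C⋆-module form a unital C⋆-algebra. -/
noncomputable instance [CompleteSpace E] : CStarAlgebra (adjointable A E) where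

end RightPreHilbertModule

/-! Operator convexity speaks only of Hilbert spaces, so a positive functional `φ` on `A` turns the
module `E ⊕ A` into a Hilbert space by completing it for `φ (⟨x, y⟩ + a⋆ b)`. It suffices to prove
the inequality under every `φ`, since positive functionals detect the order
(`nonneg_of_forall_positiveLinearMap`).

As `‖x‖ ≤ 1`, there is `d` with `⟨x, x⟩ + d⋆ d = 1`, and `v : a ↦ (x a, d a)` satisfies `v⋆ v = 1`.
Let `D = T ⊕ 0`, let `P = v v⋆` be the projection onto the closed range of `v`
(`starProjection_mk`), and `R = 2 P - 1`. The mean of `D` and `R D R` is `P D P + (1 - P) D (1 -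
P)`, and on the range of `v` it is multiplication by `v⋆ D v = ⟨x, T x⟩` (`average_mk_orbitMap`).
Midpoint convexity for `D` and `R D R`, evaluated at `v 1 = (x, d)`, which `R` fixes, gives `φ (f
⟨x, T x⟩) ≤ φ (⟨x, f(T) x⟩ + f(0) d⋆ d)`, and `f(0) ≤ 0` removes the last term.

The values of `f` on these operators are computed by comparing powers and approximating by
polynomials (`cfc_apply_eq_of_pow`). -/

/-! ### Functional calculus, spectral bounds and positive functionals -/

/-- Two self-adjoint elements whose powers have the same images under continuous linear maps have the
same images under these maps after applying a continuous function. -/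
theorem cfc_apply_eq_of_pow {B C G : Type*} [CStarAlgebra B] [CStarAlgebra C]
    [NormedAddCommGroup G] [NormedSpace ℝ G] (L₁ : B →L[ℝ] G) (L₂ : C →L[ℝ] G) {b : B} {c : C}
    (hb : IsSelfAdjoint b) (hc : IsSelfAdjoint c) (h : ∀ n : ℕ, L₁ (b ^ n) = L₂ (c ^ n))
    {m M : ℝ} (hbs : spectrum ℝ b ⊆ Set.Icc m M) (hcs : spectrum ℝ c ⊆ Set.Icc m M)
    {f : ℝ → ℝ} (hf : ContinuousOn f (Set.Icc m M)) :
    L₁ (cfc f b) = L₂ (cfc f c) := by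
  -- Weierstrass approximation: `L₁` and `L₂` are only linear, so the calculus cannot be transported
  -- by a homomorphism.
  have key : ∀ ε > 0, ‖L₁ (cfc f b) - L₂ (cfc f c)‖ ≤ (‖L₁‖ + ‖L₂‖) * ε := fun ε hε => by
    obtain ⟨p, hp⟩ := exists_polynomial_near_of_continuousOn m M f hf ε hε
    have hpoly : L₁ (cfc p.eval b) = L₂ (cfc p.eval c) := by
      rw [cfc_polynomial p b, cfc_polynomial p c, Polynomial.aeval_eq_sum_range,
        Polynomial.aeval_eq_sum_range]
      simp [h]
    have hb' : ‖cfc f b - cfc p.eval b‖ ≤ ε := by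
      rw [← cfc_sub f p.eval b (hf.mono hbs) (by fun_prop)]
      exact norm_cfc_le hε.le fun r hr => by
        rw [Real.norm_eq_abs, abs_sub_comm]; exact (hp r (hbs hr)).le
    have hc' : ‖cfc f c - cfc p.eval c‖ ≤ ε := by
      rw [← cfc_sub f p.eval c (hf.mono hcs) (by fun_prop)]
      exact norm_cfc_le hε.le fun r hr => by
        rw [Real.norm_eq_abs, abs_sub_comm]; exact (hp r (hcs hr)).le
    calc ‖L₁ (cfc f b) - L₂ (cfc f c)‖
        = ‖L₁ (cfc f b - cfc p.eval b) - L₂ (cfc f c - cfc p.eval c)‖ := by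
          rw [map_sub, map_sub, hpoly]; congr 1; abel
      _ ≤ ‖L₁‖ * ‖cfc f b - cfc p.eval b‖ + ‖L₂‖ * ‖cfc f c - cfc p.eval c‖ :=
          (norm_sub_le _ _).trans (add_le_add (L₁.le_opNorm _) (L₂.le_opNorm _))
      _ ≤ ‖L₁‖ * ε + ‖L₂‖ * ε := by gcongr
      _ = _ := by ring
  refine sub_eq_zero.1 (norm_le_zero_iff.1 ?_)
  -- The `+ 1` keeps the denominator positive when both maps vanish.
  refine le_of_forall_pos_le_add fun δ hδ => (key (δ / (‖L₁‖ + ‖L₂‖ + 1)) (by positivity)).trans ?_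
  rw [zero_add, mul_div_assoc', div_le_iff₀ (by positivity)]
  nlinarith [norm_nonneg L₁, norm_nonneg L₂]

theorem spectrum_subset_Icc_iff {B : Type*} [CStarAlgebra B] [PartialOrder B] [StarOrderedRing B]
    {b : B} (hb : IsSelfAdjoint b) {m M : ℝ} :
    spectrum ℝ b ⊆ Set.Icc m M ↔ algebraMap ℝ B m ≤ b ∧ b ≤ algebraMap ℝ B M := by
  rw [algebraMap_le_iff_le_spectrum, le_algebraMap_iff_spectrum_le]
  exact ⟨fun h => ⟨fun r hr => (h hr).1, fun r hr => (h hr).2⟩,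
    fun h r hr => ⟨h.1 r hr, h.2 r hr⟩⟩

/-- Adjoining `0` to the compact spectrum gives `m ≤ 0 ≤ M`, which is needed for `T ⊕ 0` and for
vectors of norm below one; the extreme points are attained, hence lie in `J`. -/
theorem spectrum_subset_Icc_of_ordConnected {B : Type*} [CStarAlgebra B] (b : B) {J : Set ℝ}
    (hJ : J.OrdConnected) (h0J : (0 : ℝ) ∈ J) (hb : spectrum ℝ b ⊆ J) :
    ∃ m M : ℝ, m ≤ 0 ∧ 0 ≤ M ∧ Set.Icc m M ⊆ J ∧ spectrum ℝ b ⊆ Set.Icc m M := by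
  have hs : IsCompact (insert 0 (spectrum ℝ b)) := (spectrum.isCompact b).insert 0
  have hne : (insert 0 (spectrum ℝ b)).Nonempty := ⟨0, Set.mem_insert _ _⟩
  have hsub : insert 0 (spectrum ℝ b) ⊆ J := Set.insert_subset h0J hb
  refine ⟨_, _, csInf_le hs.bddBelow (Set.mem_insert _ _),
    le_csSup hs.bddAbove (Set.mem_insert _ _),
    hJ.out (hsub (hs.sInf_mem hne)) (hsub (hs.sSup_mem hne)), fun r hr => ⟨?_, ?_⟩⟩
  · exact csInf_le hs.bddBelow (Set.mem_insert_of_mem _ hr)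
  · exact le_csSup hs.bddAbove (Set.mem_insert_of_mem _ hr)

open scoped ComplexOrder in
/-- Positive functionals detect the order of a C⋆-algebra. -/
theorem nonneg_of_forall_positiveLinearMap {B : Type*} [CStarAlgebra B] [PartialOrder B]
    [StarOrderedRing B] {a : B} (ha : IsSelfAdjoint a) (h : ∀ φ : B →ₚ[ℂ] ℂ, 0 ≤ φ a) : 0 ≤ a := by
  by_contra hneg
  have hconv : Convex ℝ {b : B | 0 ≤ b} := convex_Ici 0
  obtain ⟨l, s, hls, hs⟩ := RCLike.geometric_hahn_banach_point_closed (𝕜 := ℂ) hconv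
    (CStarAlgebra.isClosed_nonneg (A := B)) hneg
  have hs0 : s < 0 := by simpa using hs 0 le_rfl
  have hl : ∀ b : B, 0 ≤ b → 0 ≤ (l b).re := fun b hb => by
    by_contra! hlt
    -- This nonnegative multiple of `b` has real part exactly `s` under `l`, against the strict
    -- separation.
    have h1 := hs ((s / (l b).re) • b) (smul_nonneg (div_nonneg_of_nonpos hs0.le hlt.le) hb)
    rw [← Complex.coe_smul, map_smul] at h1
    simp [div_mul_cancel₀ _ hlt.ne] at h1
  -- Symmetrizing `l` keeps complex linearity and gives `2 Re l` on self-adjoint elements.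
  let ψ : B →ₗ[ℂ] ℂ :=
    { toFun := fun b => l b + star (l (star b))
      map_add' := fun b c => by simp; ring
      map_smul' := fun r b => by simp; ring }
  have hψ : ∀ b : B, IsSelfAdjoint b → ψ b = ((2 * (l b).re : ℝ) : ℂ) := fun b hb => by
    change l b + star (l (star b)) = _
    rw [hb.star_eq]
    exact Complex.add_conj _
  let φ : B →ₚ[ℂ] ℂ := PositiveLinearMap.mk₀ ψ fun b hb => by
    rw [hψ b (.of_nonneg hb)]
    exact_mod_cast mul_nonneg zero_le_two (hl b hb)
  have h1 : 0 ≤ ψ a := h φ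
  rw [hψ a ha] at h1
  have h2 : 0 ≤ 2 * (l a).re := by exact_mod_cast h1
  have h3 : (l a).re < s := hls
  linarith

/-! ### Order estimates for `⟨x, T x⟩` -/

namespace RightPreHilbertModule

variable {A E : Type*} [CStarAlgebra A] [PartialOrder A] [StarOrderedRing A]
  [NormedAddCommGroup E] [NormedSpace ℂ E] [Module Aᵐᵒᵖ E] [RightPreHilbertModule A E]

theorem inner_self_le_one {x : E} (hx : ‖x‖ ≤ 1) : inner A x x ≤ 1 := by
  rw [← CStarAlgebra.norm_le_one_iff_of_nonneg _ (inner_self_nonneg x), ← norm_sq_eq A]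
  exact pow_le_one₀ (norm_nonneg x) hx

theorem isSelfAdjoint_inner_apply {T : adjointable A E} (hT : IsSelfAdjoint T) (x : E) :
    IsSelfAdjoint (inner A x ((T : E →L[ℂ] E) x)) := by
  rw [isSelfAdjoint_iff, star_inner]
  nth_rw 2 [← hT.star_eq]
  rw [inner_star_right]

theorem inner_apply_eq {T : adjointable A E} (hT : IsSelfAdjoint T) (x y : E) :
    inner A ((T : E →L[ℂ] E) x) y = inner A x ((T : E →L[ℂ] E) y) := by
  rw [← inner_star_right, hT.star_eq]

theorem inner_apply_op_smul {T : adjointable A E} (hT : IsSelfAdjoint T) (x y : E) (a : A) :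
    inner A x ((T : E →L[ℂ] E) (MulOpposite.op a • y)) = inner A x ((T : E →L[ℂ] E) y) * a := by
  rw [← inner_apply_eq hT, inner_op_smul_right, inner_apply_eq hT]

/-- With `S = √g(T)` self-adjoint, `⟨x, S² x⟩ = ⟨S x, S x⟩`. -/
theorem inner_cfc_nonneg [CompleteSpace E] {T : adjointable A E}
    {g : ℝ → ℝ} (hg : ContinuousOn g (spectrum ℝ T)) (hg0 : ∀ r ∈ spectrum ℝ T, 0 ≤ g r) (x : E) :
    0 ≤ inner A x (((cfc g T : adjointable A E) : E →L[ℂ] E) x) := by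
  set S : adjointable A E := cfc (fun r => Real.sqrt (g r)) T with hS
  have hSa : IsSelfAdjoint S := cfc_predicate _ _
  have hSS : cfc g T = S * S := by
    have hc : ContinuousOn (fun r => Real.sqrt (g r)) (spectrum ℝ T) := hg.sqrt
    rw [hS, ← cfc_mul _ _ T hc hc]
    exact cfc_congr fun r hr => (Real.mul_self_sqrt (hg0 r hr)).symm
  have : ((S * S : adjointable A E) : E →L[ℂ] E) x = (S : E →L[ℂ] E) ((S : E →L[ℂ] E) x) := rfl
  rw [hSS, this, ← inner_apply_eq hSa]
  exact inner_self_nonneg _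

variable [CompleteSpace E] {T : adjointable A E} {m M : ℝ}

theorem smul_inner_self_le (hT : IsSelfAdjoint T) (hs : spectrum ℝ T ⊆ Set.Icc m M) (x : E) :
    m • inner A x x ≤ inner A x ((T : E →L[ℂ] E) x) := by
  have h := inner_cfc_nonneg (T := T) (g := fun r => r - m) (by fun_prop)
    (fun r hr => sub_nonneg.2 (hs hr).1) x
  rw [cfc_sub (fun r => r) (fun _ => m) T, cfc_id' ℝ T, cfc_const m T] at h
  simpa [inner_sub_right, Algebra.algebraMap_eq_smul_one, ← Complex.coe_smul, inner_smul_right,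
    -Complex.real_smul] using h

theorem inner_apply_le_smul (hT : IsSelfAdjoint T) (hs : spectrum ℝ T ⊆ Set.Icc m M) (x : E) :
    inner A x ((T : E →L[ℂ] E) x) ≤ M • inner A x x := by
  have h := inner_cfc_nonneg (T := T) (g := fun r => M - r) (by fun_prop)
    (fun r hr => sub_nonneg.2 (hs hr).2) x
  rw [cfc_sub (fun _ => M) (fun r => r) T, cfc_id' ℝ T, cfc_const M T] at h
  simpa [inner_sub_right, Algebra.algebraMap_eq_smul_one, ← Complex.coe_smul, inner_smul_right,
    -Complex.real_smul] using h

/-- Since `m ≤ 0 ≤ M`, every spectral value has modulus at most `M - m`. The bound is needed in the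
order of `A`, not just in norm, so that it survives applying `φ`. -/
theorem inner_apply_apply_le (hT : IsSelfAdjoint T) (hm : m ≤ 0) (hM : 0 ≤ M)
    (hs : spectrum ℝ T ⊆ Set.Icc m M) (x : E) :
    inner A ((T : E →L[ℂ] E) x) ((T : E →L[ℂ] E) x) ≤ (M - m) ^ 2 • inner A x x := by
  have h := inner_cfc_nonneg (T := T) (g := fun r => (M - m) ^ 2 - r ^ 2) (by fun_prop)
    (fun r hr => by have := hs hr; simp only [Set.mem_Icc] at this; nlinarith) x
  rw [cfc_sub (fun _ => (M - m) ^ 2) (fun r => r ^ 2) T, cfc_pow_id T 2,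
    cfc_const ((M - m) ^ 2) T] at h
  rw [inner_apply_eq hT]
  simpa [inner_sub_right, Algebra.algebraMap_eq_smul_one, ← Complex.coe_smul, inner_smul_right,
    -Complex.real_smul, pow_two (T : E →L[ℂ] E)] using h

theorem spectrum_inner_apply_subset (hT : IsSelfAdjoint T) (hm : m ≤ 0) (hM : 0 ≤ M)
    (hs : spectrum ℝ T ⊆ Set.Icc m M) {x : E} (hx : ‖x‖ ≤ 1) :
    spectrum ℝ (inner A x ((T : E →L[ℂ] E) x)) ⊆ Set.Icc m M := by
  rw [spectrum_subset_Icc_iff (isSelfAdjoint_inner_apply hT x), Algebra.algebraMap_eq_smul_one,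
    Algebra.algebraMap_eq_smul_one]
  exact ⟨(smul_le_smul_of_nonpos_left (inner_self_le_one hx) hm).trans (smul_inner_self_le hT hs x),
    (inner_apply_le_smul hT hs x).trans (smul_le_smul_of_nonneg_left (inner_self_le_one hx) hM)⟩

end RightPreHilbertModule

/-! ### The Hilbert space of a positive functional and the operator `T ⊕ 0` -/

namespace RightPreHilbertModule

open scoped ComplexOrder InnerProductSpace
open UniformSpace

variable {A : Type u} {E : Type v} [CStarAlgebra A] [PartialOrder A]
  [NormedAddCommGroup E] [NormedSpace ℂ E] [Module Aᵐᵒᵖ E] [RightPreHilbertModule A E]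

variable (E) in
set_option linter.unusedVariables false in
/-- The space `E × A` with the semi-inner product `φ (⟨x, y⟩ + a⋆ b)` of `(x, a)` and `(y, b)`
induced by a positive functional `φ` on `A`. -/
def PreLocalization (φ : A →ₚ[ℂ] ℂ) : Type max u v := E × A

namespace PreLocalization

variable (φ : A →ₚ[ℂ] ℂ)

noncomputable instance : AddCommGroup (PreLocalization E φ) := inferInstanceAs (AddCommGroup (E × A))
noncomputable instance : Module ℂ (PreLocalization E φ) := inferInstanceAs (Module ℂ (E × A))

variable [StarOrderedRing A]

/-- The semi-inner product of `PreLocalization E φ`. -/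
noncomputable abbrev core : PreInnerProductSpace.Core ℂ (PreLocalization E φ) where
  inner p q := φ (inner A p.1 q.1 + star p.2 * q.2)
  conj_inner_symm p q := by
    rw [← Complex.star_def, ← map_star φ, star_add, star_inner, star_mul, star_star]
  re_inner_nonneg p := (RCLike.nonneg_iff.mp
    (φ.map_nonneg (add_nonneg (inner_self_nonneg p.1) (star_mul_self_nonneg p.2)))).1
  add_left p q r := by
    change φ (inner A (p.1 + q.1) r.1 + star (p.2 + q.2) * r.2) = _
    rw [inner_add_left, star_add, add_mul, ← map_add]
    congr 1; abel
  smul_left p q c := by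
    change φ (inner A (c • p.1) q.1 + star (c • p.2) * q.2) = _
    rw [inner_smul_left, star_smul, smul_mul_assoc, ← smul_add, map_smul]
    rfl

noncomputable instance : SeminormedAddCommGroup (PreLocalization E φ) :=
  InnerProductSpace.Core.toSeminormedAddCommGroup (c := core φ)
noncomputable instance : InnerProductSpace ℂ (PreLocalization E φ) :=
  InnerProductSpace.ofCore (core φ)

variable {φ}

theorem inner_def (p q : PreLocalization E φ) :
    ⟪p, q⟫_ℂ = φ (inner A p.1 q.1 + star p.2 * q.2) := rfl

theorem norm_sq_le_of_le {p q : PreLocalization E φ} {c : ℝ}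
    (h : inner A p.1 p.1 + star p.2 * p.2 ≤ c • (inner A q.1 q.1 + star q.2 * q.2)) :
    ‖p‖ ^ 2 ≤ c * ‖q‖ ^ 2 := by
  have h1 := OrderHomClass.mono φ h
  rw [← Complex.coe_smul, map_smul, ← inner_def, ← inner_def, inner_self_eq_norm_sq_to_K,
    inner_self_eq_norm_sq_to_K, smul_eq_mul] at h1
  rw [← Complex.real_le_real]
  push_cast
  exact h1

/-- The operator `(x, a) ↦ (T x, 0)`. -/
noncomputable def diagMap [CompleteSpace E] (T : adjointable A E) (hT : IsSelfAdjoint T) {m M : ℝ}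
    (hm : m ≤ 0) (hM : 0 ≤ M) (hs : spectrum ℝ T ⊆ Set.Icc m M) :
    PreLocalization E φ →L[ℂ] PreLocalization E φ :=
  LinearMap.mkContinuous
    { toFun := fun p => ((T : E →L[ℂ] E) p.1, (0 : A))
      map_add' := fun p q => Prod.ext (map_add (T : E →L[ℂ] E) p.1 q.1) (add_zero 0).symm
      map_smul' := fun c p => Prod.ext (map_smul (T : E →L[ℂ] E) c p.1) (smul_zero c).symm }
    (M - m) fun p => by
      refine (pow_le_pow_iff_left₀ (norm_nonneg _)
        (mul_nonneg (by linarith) (norm_nonneg _)) two_ne_zero).1 ?_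
      rw [mul_pow]
      refine norm_sq_le_of_le ?_
      change inner A ((T : E →L[ℂ] E) p.1) ((T : E →L[ℂ] E) p.1) + star (0 : A) * 0 ≤ _
      rw [mul_zero, add_zero, smul_add]
      exact (inner_apply_apply_le hT hm hM hs _).trans
        (le_add_of_nonneg_right (smul_nonneg (sq_nonneg _) (star_mul_self_nonneg _)))

end PreLocalization

variable [StarOrderedRing A]

variable (E) in
/-- The Hilbert space completion of `PreLocalization E φ`. -/
abbrev Localization (φ : A →ₚ[ℂ] ℂ) : Type max u v := Completion (PreLocalization E φ)

namespace Localization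

variable (φ : A →ₚ[ℂ] ℂ)

variable (E) in
/-- The canonical map from `E × A` to its localization. -/
noncomputable def mk : E × A →L[ℂ] Localization E φ :=
  LinearMap.mkContinuousOfExistsBound
    { toFun := fun p => ((show PreLocalization E φ from p : PreLocalization E φ) :
        Completion (PreLocalization E φ))
      map_add' := fun p q => Completion.coe_add (α := PreLocalization E φ) p q
      map_smul' := fun c p => Completion.coe_smul (X := PreLocalization E φ) c p } <| by
    obtain ⟨C, hC⟩ := PositiveLinearMap.exists_norm_apply_le φ
    -- The factor `2` counts the two summands, each at most `‖p‖ ^ 2` for the sup norm of `E × A`.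
    refine ⟨Real.sqrt (2 * C), fun p => ?_⟩
    refine (pow_le_pow_iff_left₀ (norm_nonneg _) (by positivity) two_ne_zero).1 ?_
    rw [mul_pow, Real.sq_sqrt (by positivity)]
    change ‖((show PreLocalization E φ from p : PreLocalization E φ) :
        Completion (PreLocalization E φ))‖ ^ 2 ≤ _
    rw [Completion.norm_coe]
    have h : ‖inner A p.1 p.1 + star p.2 * p.2‖ ≤ 2 * ‖p‖ ^ 2 := by
      refine (norm_add_le _ _).trans ?_
      rw [← norm_sq_eq A, CStarRing.norm_star_mul_self, ← sq, two_mul]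
      gcongr
      exacts [norm_fst_le p, norm_snd_le p]
    have h1 : (‖(show PreLocalization E φ from p)‖ : ℝ) ^ 2 =
        ‖φ (inner A p.1 p.1 + star p.2 * p.2)‖ := by
      have := inner_self_eq_norm_sq_to_K (𝕜 := ℂ) (show PreLocalization E φ from p)
      rw [PreLocalization.inner_def] at this
      rw [this]
      simp
    rw [h1]
    calc _ ≤ C * (2 * ‖p‖ ^ 2) := (hC _).trans (by gcongr)
      _ = _ := by ring

variable {φ}

theorem inner_mk (p q : E × A) :
    ⟪mk E φ p, mk E φ q⟫_ℂ = φ (inner A p.1 q.1 + star p.2 * q.2) :=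
  Completion.inner_coe (E := PreLocalization E φ) p q

theorem induction_on {motive : Localization E φ → Prop} (w : Localization E φ)
    (hc : IsClosed {w | motive w}) (h : ∀ p, motive (mk E φ p)) : motive w :=
  Completion.induction_on w hc h

variable [CompleteSpace E] {T : adjointable A E} (hT : IsSelfAdjoint T) {m M : ℝ}
  (hm : m ≤ 0) (hM : 0 ≤ M) (hs : spectrum ℝ T ⊆ Set.Icc m M)

variable (φ) in
/-- The operator on the localization that extends `(x, a) ↦ (T x, 0)`. -/
noncomputable def diag : Localization E φ →L[ℂ] Localization E φ :=
  (PreLocalization.diagMap T hT hm hM hs).completion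

theorem diag_mk (p : E × A) :
    diag φ hT hm hM hs (mk E φ p) = mk E φ ((T : E →L[ℂ] E) p.1, 0) :=
  ContinuousLinearMap.completion_apply_coe (PreLocalization.diagMap T hT hm hM hs) _

theorem isSelfAdjoint_diag : IsSelfAdjoint (diag φ hT hm hM hs) := by
  rw [ContinuousLinearMap.isSelfAdjoint_iff_isSymmetric]
  intro w z
  induction w using induction_on with
  | hc => exact isClosed_eq (by fun_prop) (by fun_prop)
  | h p =>
    induction z using induction_on with
    | hc => exact isClosed_eq (by fun_prop) (by fun_prop)
    | h q =>
      change ⟪diag φ hT hm hM hs (mk E φ p), _⟫_ℂ = ⟪_, diag φ hT hm hM hs (mk E φ q)⟫_ℂ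
      simp only [diag_mk, inner_mk, inner_apply_eq hT, star_zero, zero_mul, mul_zero]

/-- The quadratic forms are checked on the dense image of `E × A`. The second summand contributes
`-m a⋆ a` and `M a⋆ a`, which is where the signs of `m` and `M` enter. -/
theorem spectrum_diag_subset : spectrum ℝ (diag φ hT hm hM hs) ⊆ Set.Icc m M := by
  rw [spectrum_subset_Icc_iff (isSelfAdjoint_diag hT hm hM hs),
    ContinuousLinearMap.le_def, ContinuousLinearMap.le_def, ContinuousLinearMap.isPositive_iff',
    ContinuousLinearMap.isPositive_iff']
  refine ⟨⟨(isSelfAdjoint_diag hT hm hM hs).sub (.algebraMap _ (.all m)), fun w => ?_⟩,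
    ⟨(IsSelfAdjoint.algebraMap _ (.all M)).sub (isSelfAdjoint_diag hT hm hM hs), fun w => ?_⟩⟩ <;>
  induction w using induction_on with
  | hc => exact isClosed_le (by fun_prop) (by fun_prop)
  | h p => ?_
  · have : (diag φ hT hm hM hs - algebraMap ℝ _ m) (mk E φ p) =
        mk E φ ((T : E →L[ℂ] E) p.1 - (m : ℂ) • p.1, -((m : ℂ) • p.2)) := by
      rw [sub_apply, diag_mk, Algebra.algebraMap_eq_smul_one,
        smul_apply, one_apply_eq_self, ← Complex.coe_smul,
        ← map_smul, ← map_sub]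
      congr 1
      exact Prod.ext rfl (zero_sub _)
    rw [← inner_conj_symm, this, inner_mk]
    refine star_nonneg_iff.2 (φ.map_nonneg (add_nonneg ?_ ?_))
    · rw [inner_sub_right, inner_smul_right, Complex.coe_smul]
      exact sub_nonneg.2 (smul_inner_self_le hT hs _)
    · rw [mul_neg, mul_smul_comm, Complex.coe_smul, ← neg_smul]
      exact smul_nonneg (neg_nonneg.2 hm) (star_mul_self_nonneg _)
  · have : (algebraMap ℝ _ M - diag φ hT hm hM hs) (mk E φ p) =
        mk E φ ((M : ℂ) • p.1 - (T : E →L[ℂ] E) p.1, (M : ℂ) • p.2) := by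
      rw [sub_apply, diag_mk, Algebra.algebraMap_eq_smul_one,
        smul_apply, one_apply_eq_self, ← Complex.coe_smul,
        ← map_smul, ← map_sub]
      congr 1
      exact Prod.ext rfl (sub_zero _)
    rw [← inner_conj_symm, this, inner_mk]
    refine star_nonneg_iff.2 (φ.map_nonneg (add_nonneg ?_ ?_))
    · rw [inner_sub_right, inner_smul_right, Complex.coe_smul]
      exact sub_nonneg.2 (inner_apply_le_smul hT hs _)
    · rw [mul_smul_comm, Complex.coe_smul]
      exact smul_nonneg hM (star_mul_self_nonneg _)

end Localization
end RightPreHilbertModule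

/-! ### The cyclic subspace, its reflection and the averaged operator -/

namespace RightPreHilbertModule

open scoped ComplexOrder InnerProductSpace

variable {A : Type u} {E : Type v} [CStarAlgebra A] [PartialOrder A] [StarOrderedRing A]
  [NormedAddCommGroup E] [NormedSpace ℂ E] [Module Aᵐᵒᵖ E] [RightPreHilbertModule A E]

omit [StarOrderedRing A] in
theorem norm_op_smul_le (a : A) (x : E) : ‖MulOpposite.op a • x‖ ≤ ‖x‖ * ‖a‖ := by
  refine (pow_le_pow_iff_left₀ (norm_nonneg _) (by positivity) two_ne_zero).1 ?_
  rw [norm_sq_eq A, inner_op_smul_left, inner_op_smul_right, mul_pow, norm_sq_eq A x]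
  calc _ ≤ ‖star a‖ * (‖inner A x x‖ * ‖a‖) :=
        (norm_mul_le _ _).trans (by gcongr; exact norm_mul_le _ _)
    _ = _ := by rw [norm_star]; ring

/-- The map `a ↦ (x a, d a)`. -/
noncomputable def orbitMap (x : E) (d : A) : A →L[ℂ] E × A :=
  (LinearMap.mkContinuous
    { toFun := fun a => MulOpposite.op a • x
      map_add' := fun a b => by rw [MulOpposite.op_add, add_smul]
      map_smul' := fun c a => (smul_op_smul x a c).1.symm } ‖x‖
    fun a => norm_op_smul_le a x).prod (ContinuousLinearMap.mul ℂ A d)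

omit [StarOrderedRing A] in
theorem orbitMap_apply (x : E) (d a : A) : orbitMap x d a = (MulOpposite.op a • x, d * a) := rfl

namespace Localization

variable {φ : A →ₚ[ℂ] ℂ} {x : E} {d : A}

variable (φ x d) in
/-- The closed submodule generated by the class of `(x, d)`. -/
noncomputable abbrev cyclic : Submodule ℂ (Localization E φ) :=
  ((mk E φ ∘L orbitMap x d).range).topologicalClosure

theorem mk_orbitMap_mem (a : A) : mk E φ (orbitMap x d a) ∈ cyclic φ x d :=
  Submodule.le_topologicalClosure _ ⟨a, rfl⟩

instance : CompleteSpace (cyclic φ x d) :=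
  (Submodule.isClosed_topologicalClosure _).completeSpace_coe

/-- For `v : a ↦ (x a, d a)` the adjoint is `v⋆ (y, a) = ⟨x, y⟩ + d⋆ a`, and `h` is `v⋆ v = 1`; thus
`v v⋆` is the projection, and `p - v v⋆ p` is orthogonal to each `v b`. -/
theorem starProjection_mk (h : inner A x x + star d * d = 1) (p : E × A) :
    (cyclic φ x d).starProjection (mk E φ p) =
      mk E φ (orbitMap x d (inner A x p.1 + star d * p.2)) := by
  refine Submodule.eq_starProjection_of_mem_orthogonal
    (mk_orbitMap_mem (φ := φ) (x := x) (d := d) (inner A x p.1 + star d * p.2)) ?_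
  rw [Submodule.orthogonal_closure, Submodule.mem_orthogonal']
  rintro _ ⟨b, rfl⟩
  change ⟪_, mk E φ (orbitMap x d b)⟫_ℂ = 0
  rw [← map_sub, inner_mk, orbitMap_apply, orbitMap_apply, Prod.fst_sub, Prod.snd_sub]
  convert map_zero φ
  set t := inner A x p.1 + star d * p.2 with ht
  have ht' : star t = inner A p.1 x + star p.2 * d := by simp [ht, star_inner]
  have : (inner A p.1 x - star t * inner A x x) * b + (star p.2 - star t * star d) * (d * b) =
      (inner A p.1 x + star p.2 * d) * b - star t * ((inner A x x + star d * d) * b) := by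
    noncomm_ring
  simp only [inner_sub_left, inner_op_smul_left, inner_op_smul_right, star_sub, star_mul]
  rw [this, h, one_mul, ht', sub_self]

theorem starProjection_mk_orbitMap (a : A) :
    (cyclic φ x d).starProjection (mk E φ (orbitMap x d a)) = mk E φ (orbitMap x d a) :=
  Submodule.starProjection_eq_self_iff.2 (mk_orbitMap_mem a)

variable (φ x d) in
/-- The reflection in the cyclic submodule generated by `(x, d)`. -/
noncomputable def reflect : Localization E φ →L[ℂ] Localization E φ :=
  (2 : ℝ) • (cyclic φ x d).starProjection - 1

theorem isSelfAdjoint_reflect : IsSelfAdjoint (reflect φ x d) :=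
  ((IsSelfAdjoint.all (2 : ℝ)).smul (isSelfAdjoint_starProjection _)).sub (.one _)

theorem reflect_mul_reflect : reflect φ x d * reflect φ x d = 1 := by
  have h : (cyclic φ x d).starProjection * (cyclic φ x d).starProjection =
    (cyclic φ x d).starProjection := (Submodule.isIdempotentElem_starProjection _).eq
  simp only [reflect, sub_mul, mul_sub, smul_mul_smul, h, mul_one, one_mul]
  module

theorem reflect_mk_orbitMap (a : A) :
    reflect φ x d (mk E φ (orbitMap x d a)) = mk E φ (orbitMap x d a) := by
  change (2 : ℝ) • (cyclic φ x d).starProjection _ - mk E φ (orbitMap x d a) = _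
  rw [starProjection_mk_orbitMap, two_smul, add_sub_cancel_right]

variable [CompleteSpace E] {T : adjointable A E} (hT : IsSelfAdjoint T) {m M : ℝ}
  (hm : m ≤ 0) (hM : 0 ≤ M) (hs : spectrum ℝ T ⊆ Set.Icc m M)

variable (φ x d) in
/-- The conjugate of `diag φ hT hm hM hs` by the reflection in the cyclic submodule. -/
noncomputable def conjDiag : Localization E φ →L[ℂ] Localization E φ :=
  reflect φ x d * diag φ hT hm hM hs * reflect φ x d

theorem isSelfAdjoint_conjDiag : IsSelfAdjoint (conjDiag φ x d hT hm hM hs) := by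
  have h := (isSelfAdjoint_diag (φ := φ) hT hm hM hs).conjugate (reflect φ x d)
  rwa [isSelfAdjoint_reflect.star_eq] at h

/-- Conjugation by the self-adjoint unitary `R` preserves order and fixes scalars. -/
theorem spectrum_conjDiag_subset :
    spectrum ℝ (conjDiag φ x d hT hm hM hs) ⊆ Set.Icc m M := by
  obtain ⟨h1, h2⟩ := (spectrum_subset_Icc_iff (isSelfAdjoint_diag hT hm hM hs)).1
    (spectrum_diag_subset (φ := φ) hT hm hM hs)
  have h3 (r : ℝ) : star (reflect φ x d) * algebraMap ℝ _ r * reflect φ x d =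
      algebraMap ℝ _ r := by
    rw [isSelfAdjoint_reflect.star_eq, mul_assoc, Algebra.commutes, ← mul_assoc,
      reflect_mul_reflect, one_mul]
  rw [spectrum_subset_Icc_iff (isSelfAdjoint_conjDiag hT hm hM hs), ← h3 m, ← h3 M, conjDiag]
  -- Occurrences 3 and 5 are the left factors of the two copies of `R D R`; as stars they exhibit a
  -- conjugation.
  nth_rw 3 [← (isSelfAdjoint_reflect (φ := φ) (x := x) (d := d)).star_eq]
  nth_rw 5 [← (isSelfAdjoint_reflect (φ := φ) (x := x) (d := d)).star_eq]
  exact ⟨star_left_conjugate_le_conjugate h1 _, star_left_conjugate_le_conjugate h2 _⟩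

theorem conjDiag_pow (n : ℕ) : conjDiag φ x d hT hm hM hs ^ n =
    reflect φ x d * diag φ hT hm hM hs ^ n * reflect φ x d := by
  induction n with
  | zero => rw [pow_zero, pow_zero, mul_one, reflect_mul_reflect]
  | succ n ih =>
    rw [pow_succ, ih, conjDiag, pow_succ]
    calc _ = reflect φ x d * diag φ hT hm hM hs ^ n * (reflect φ x d * reflect φ x d) *
        diag φ hT hm hM hs * reflect φ x d := by simp only [mul_assoc]
      _ = _ := by rw [reflect_mul_reflect, mul_one]; simp only [mul_assoc]

/-- Evaluation of operators at a vector, as a real-linear map. -/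
noncomputable abbrev evalAt (w : Localization E φ) :
    (Localization E φ →L[ℂ] Localization E φ) →L[ℝ] Localization E φ :=
  (ContinuousLinearMap.apply ℂ (Localization E φ) w).restrictScalars ℝ

variable {f : ℝ → ℝ} (hf : ContinuousOn f (Set.Icc m M))
include hf

/-- `f(R D R) = R f(D) R`, and the right-hand `R` fixes the vector. -/
theorem cfc_conjDiag_mk_orbitMap (a : A) :
    cfc f (conjDiag φ x d hT hm hM hs) (mk E φ (orbitMap x d a)) =
      reflect φ x d (cfc f (diag φ hT hm hM hs) (mk E φ (orbitMap x d a))) := by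
  refine cfc_apply_eq_of_pow (evalAt (mk E φ (orbitMap x d a)))
    ((reflect φ x d).restrictScalars ℝ ∘L evalAt (mk E φ (orbitMap x d a)))
    (isSelfAdjoint_conjDiag hT hm hM hs) (isSelfAdjoint_diag hT hm hM hs) (fun n => ?_)
    (spectrum_conjDiag_subset hT hm hM hs) (spectrum_diag_subset hT hm hM hs) hf
  change (conjDiag φ x d hT hm hM hs ^ n) (mk E φ (orbitMap x d a)) = _
  rw [conjDiag_pow, mul_apply_eq_comp, reflect_mk_orbitMap]
  rfl

theorem cfc_diag_mk_fst (y : E) :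
    cfc f (diag φ hT hm hM hs) (mk E φ (y, 0)) =
      mk E φ (((cfc f T : adjointable A E) : E →L[ℂ] E) y, 0) := by
  let val : adjointable A E →L[ℂ] E →L[ℂ] E :=
    ⟨(adjointable A E).val.toLinearMap, continuous_subtype_val⟩
  let L : adjointable A E →L[ℂ] Localization E φ :=
    mk E φ ∘L .inl ℂ E A ∘L ContinuousLinearMap.apply ℂ E y ∘L val
  refine cfc_apply_eq_of_pow (evalAt (mk E φ (y, 0))) (L.restrictScalars ℝ)
    (isSelfAdjoint_diag hT hm hM hs) hT (fun n => ?_) (spectrum_diag_subset hT hm hM hs) hs hf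
  change (diag φ hT hm hM hs ^ n) (mk E φ (y, 0)) =
    mk E φ (((T ^ n : adjointable A E) : E →L[ℂ] E) y, 0)
  induction n with
  | zero => rw [pow_zero, pow_zero]; rfl
  | succ n ih => rw [pow_succ', mul_apply_eq_comp, ih, pow_succ', diag_mk]; rfl

/-- `D` vanishes on `0 ⊕ A`, so its powers there match those of `0 : A`, including `0 ^ 0 = 1`; this
is the source of the term `f 0`. -/
theorem cfc_diag_mk_snd (a : A) :
    cfc f (diag φ hT hm hM hs) (mk E φ (0, a)) = mk E φ (0, f 0 • a) := by
  let L : A →L[ℂ] Localization E φ :=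
    mk E φ ∘L .inr ℂ E A ∘L (ContinuousLinearMap.mul ℂ A).flip a
  have h0 : spectrum ℝ (0 : A) ⊆ Set.Icc m M := by
    rw [spectrum_subset_Icc_iff (.zero A), ← map_zero (algebraMap ℝ A)]
    exact ⟨algebraMap_mono A hm, algebraMap_mono A hM⟩
  refine (cfc_apply_eq_of_pow (evalAt (mk E φ (0, a))) (L.restrictScalars ℝ)
    (isSelfAdjoint_diag hT hm hM hs) (.zero A) (fun n => ?_)
    (spectrum_diag_subset hT hm hM hs) h0 hf).trans ?_
  · change (diag φ hT hm hM hs ^ n) (mk E φ (0, a)) = mk E φ (0, 0 ^ n * a)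
    induction n with
    | zero => rw [pow_zero, pow_zero, one_mul]; rfl
    | succ n ih =>
      rw [pow_succ', mul_apply_eq_comp, ih, pow_succ', diag_mk, map_zero, zero_mul, zero_mul]
  · change mk E φ (0, cfc f (0 : A) * a) = _
    rw [cfc_apply_zero, Algebra.algebraMap_eq_smul_one, smul_mul_assoc, one_mul]

theorem cfc_diag_mk (p : E × A) :
    cfc f (diag φ hT hm hM hs) (mk E φ p) =
      mk E φ (((cfc f T : adjointable A E) : E →L[ℂ] E) p.1, f 0 • p.2) := by
  rw [← Prod.fst_add_snd p, map_add, map_add, cfc_diag_mk_fst hT hm hM hs hf,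
    cfc_diag_mk_snd hT hm hM hs hf, ← map_add]
  simp

-- On the range of `v` the reflection is the identity, so the mean is `½ D + ½ (2 P - 1) D = P D`,
-- and `P D v = v v⋆ D v` with `v⋆ D v = ⟨x, T x⟩`.
omit hf in
theorem average_mk_orbitMap (h : inner A x x + star d * d = 1) (a : A) :
    ((1 - (1 / 2 : ℝ)) • diag φ hT hm hM hs + (1 / 2 : ℝ) • conjDiag φ x d hT hm hM hs)
        (mk E φ (orbitMap x d a)) =
      mk E φ (orbitMap x d (inner A x ((T : E →L[ℂ] E) x) * a)) := by
  change (1 - (1 / 2 : ℝ)) • diag φ hT hm hM hs (mk E φ (orbitMap x d a)) +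
    (1 / 2 : ℝ) • reflect φ x d (diag φ hT hm hM hs (reflect φ x d (mk E φ (orbitMap x d a)))) = _
  rw [reflect_mk_orbitMap, diag_mk]
  change _ + (1 / 2 : ℝ) • ((2 : ℝ) • (cyclic φ x d).starProjection (mk E φ _) - mk E φ _) = _
  rw [starProjection_mk h, mul_zero, add_zero, orbitMap_apply, inner_apply_op_smul hT]
  module

theorem cfc_average_mk_orbitMap (h : inner A x x + star d * d = 1) (hx : ‖x‖ ≤ 1) :
    cfc f ((1 - (1 / 2 : ℝ)) • diag φ hT hm hM hs + (1 / 2 : ℝ) • conjDiag φ x d hT hm hM hs)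
        (mk E φ (orbitMap x d 1)) =
      mk E φ (orbitMap x d (cfc f (inner A x ((T : E →L[ℂ] E) x)))) := by
  set Y := (1 - (1 / 2 : ℝ)) • diag φ hT hm hM hs + (1 / 2 : ℝ) • conjDiag φ x d hT hm hM hs
    with hY
  have hYs : IsSelfAdjoint Y :=
    ((IsSelfAdjoint.all _).smul (isSelfAdjoint_diag hT hm hM hs)).add
      ((IsSelfAdjoint.all _).smul (isSelfAdjoint_conjDiag hT hm hM hs))
  have hYspec : spectrum ℝ Y ⊆ Set.Icc m M := by
    obtain ⟨h1, h2⟩ := (spectrum_subset_Icc_iff (isSelfAdjoint_diag hT hm hM hs)).1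
      (spectrum_diag_subset (φ := φ) hT hm hM hs)
    obtain ⟨h3, h4⟩ := (spectrum_subset_Icc_iff (isSelfAdjoint_conjDiag hT hm hM hs)).1
      (spectrum_conjDiag_subset (φ := φ) (x := x) (d := d) hT hm hM hs)
    rw [spectrum_subset_Icc_iff hYs]
    -- Order intervals are convex, so the mean inherits the spectral bounds.
    exact convex_Icc _ _ ⟨h1, h2⟩ ⟨h3, h4⟩ (by norm_num) (by norm_num) (by norm_num)
  refine cfc_apply_eq_of_pow (evalAt (mk E φ (orbitMap x d 1)))
    ((mk E φ ∘L orbitMap x d).restrictScalars ℝ) hYs (isSelfAdjoint_inner_apply hT x) (fun n => ?_)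
    hYspec (spectrum_inner_apply_subset hT hm hM hs hx) hf
  change (Y ^ n) (mk E φ (orbitMap x d 1)) =
    mk E φ (orbitMap x d (inner A x ((T : E →L[ℂ] E) x) ^ n))
  induction n with
  | zero => rw [pow_zero, pow_zero, one_apply_eq_self]
  | succ n ih =>
    rw [pow_succ', mul_apply_eq_comp, ih, hY, average_mk_orbitMap hT hm hM hs h,
      ← pow_succ']

end Localization

/-! ### The Jensen inequality -/

/-- The Jensen inequality under a positive functional. -/
theorem map_cfc_inner_le [CompleteSpace E] (φ : A →ₚ[ℂ] ℂ) {T : adjointable A E}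
    (hT : IsSelfAdjoint T) {m M : ℝ} (hm : m ≤ 0) (hM : 0 ≤ M)
    (hs : spectrum ℝ T ⊆ Set.Icc m M) {J : Set ℝ} (hJ : Set.Icc m M ⊆ J) {f : ℝ → ℝ}
    (hf : OperatorConvexOn.{max u v} J f) (hf0 : f 0 ≤ 0) {x : E} (hx : ‖x‖ ≤ 1) :
    φ (cfc f (inner A x ((T : E →L[ℂ] E) x))) ≤
      φ (inner A x (((cfc f T : adjointable A E) : E →L[ℂ] E) x)) := by
  obtain ⟨d, hd⟩ : ∃ d : A, 1 - inner A x x = star d * d :=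
    CStarAlgebra.nonneg_iff_eq_star_mul_self.1 (sub_nonneg.2 (inner_self_le_one hx))
  have h : inner A x x + star d * d = 1 := by rw [← hd]; abel
  have hc : ContinuousOn f (Set.Icc m M) := hf.1.mono hJ
  -- The localization lives in `Type (max u v)`, which fixes the universe of the convexity
  -- hypothesis.
  have hconv := hf.2 (Localization E φ) (Localization.diag φ hT hm hM hs)
    (Localization.conjDiag φ x d hT hm hM hs) (1 / 2)
    (Localization.isSelfAdjoint_diag hT hm hM hs) (Localization.isSelfAdjoint_conjDiag hT hm hM hs)
    ((Localization.spectrum_diag_subset hT hm hM hs).trans hJ)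
    ((Localization.spectrum_conjDiag_subset hT hm hM hs).trans hJ) (by norm_num) (by norm_num)
  set w := Localization.mk E φ (orbitMap x d 1) with hw
  have hpos := ((ContinuousLinearMap.le_def _ _).1 hconv).inner_nonneg_right w
  -- `⟨w, R f(D) w⟩ = ⟨R w, f(D) w⟩` and `R w = w`, so both halves of the right-hand side agree at
  -- `w`.
  have hR : ⟪w, cfc f (Localization.conjDiag φ x d hT hm hM hs) w⟫_ℂ =
      ⟪w, cfc f (Localization.diag φ hT hm hM hs) w⟫_ℂ := by
    rw [Localization.cfc_conjDiag_mk_orbitMap hT hm hM hs hc]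
    exact (((ContinuousLinearMap.isSelfAdjoint_iff_isSymmetric.1
      (Localization.isSelfAdjoint_reflect (φ := φ) (x := x) (d := d))) w _).symm).trans
        (congrArg (⟪·, _⟫_ℂ) (Localization.reflect_mk_orbitMap 1))
  have hle : ⟪w, cfc f ((1 - (1 / 2 : ℝ)) • Localization.diag φ hT hm hM hs +
      (1 / 2 : ℝ) • Localization.conjDiag φ x d hT hm hM hs) w⟫_ℂ ≤
      ⟪w, cfc f (Localization.diag φ hT hm hM hs) w⟫_ℂ := by
    refine sub_nonneg.1 (hpos.trans_eq ?_)
    rw [sub_apply, add_apply, smul_apply, smul_apply, _root_.inner_sub_right,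
      _root_.inner_add_right, ← Complex.coe_smul, ← Complex.coe_smul, _root_.inner_smul_right,
      _root_.inner_smul_right, hR]
    push_cast
    ring
  rw [Localization.cfc_average_mk_orbitMap hT hm hM hs hc h hx, hw,
    Localization.cfc_diag_mk hT hm hM hs hc, Localization.inner_mk, Localization.inner_mk] at hle
  simp only [orbitMap_apply, MulOpposite.op_one, one_smul, mul_one, inner_op_smul_right] at hle
  -- On the left, `⟨x, x⟩ + d⋆ d = 1` collapses `⟨v 1, v c⟩` to `c = f ⟨x, T x⟩`; on the right `f 0
  -- • (d⋆ d)` is left over.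
  rw [← mul_assoc, ← add_mul, h, one_mul, mul_smul_comm] at hle
  refine hle.trans (OrderHomClass.mono φ ?_)
  exact add_le_of_nonpos_right (smul_nonpos_of_nonpos_of_nonneg hf0 (star_mul_self_nonneg d))

/-- The Jensen inequality for operators with spectrum in an interval around zero. -/
theorem cfc_inner_le [CompleteSpace E] {T : adjointable A E}
    (hT : IsSelfAdjoint T) {m M : ℝ} (hm : m ≤ 0) (hM : 0 ≤ M)
    (hs : spectrum ℝ T ⊆ Set.Icc m M) {J : Set ℝ} (hJ : Set.Icc m M ⊆ J) {f : ℝ → ℝ}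
    (hf : OperatorConvexOn.{max u v} J f) (hf0 : f 0 ≤ 0) {x : E} (hx : ‖x‖ ≤ 1) :
    cfc f (inner A x ((T : E →L[ℂ] E) x)) ≤
      inner A x (((cfc f T : adjointable A E) : E →L[ℂ] E) x) := by
  refine sub_nonneg.1 (nonneg_of_forall_positiveLinearMap ?_ fun φ => ?_)
  · exact (isSelfAdjoint_inner_apply (cfc_predicate f T) x).sub (cfc_predicate f _)
  · rw [map_sub]
    exact sub_nonneg.2 (map_cfc_inner_le φ hT hm hM hs hJ hf hf0 hx)

end RightPreHilbertModule

theorem mainTheorem4 {A : Type u} {E : Type v}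
    [CStarAlgebra A] [PartialOrder A] [StarOrderedRing A]
    [NormedAddCommGroup E] [NormedSpace ℂ E] [CompleteSpace E] [Module Aᵐᵒᵖ E]
    [RightPreHilbertModule A E]
    (J : Set ℝ) (hJ : J.OrdConnected) (h0J : (0 : ℝ) ∈ J)
    (f : ℝ → ℝ) (hf : OperatorConvexOn.{max u v} J f) (hf0 : f 0 ≤ 0)
    (T : RightPreHilbertModule.adjointable A E) (hT : IsSelfAdjoint T) (hTJ : spectrum ℝ T ⊆ J)
    (x : E) (hx : ‖x‖ ≤ 1) :
    IsSelfAdjoint (inner A x ((T : E →L[ℂ] E) x)) ∧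
      spectrum ℝ (inner A x ((T : E →L[ℂ] E) x)) ⊆ J ∧
      cfc f (inner A x ((T : E →L[ℂ] E) x)) ≤
        inner A x (((cfc f T : RightPreHilbertModule.adjointable A E) : E →L[ℂ] E) x) := by
  obtain ⟨m, M, hm, hM, hmM, hs⟩ := spectrum_subset_Icc_of_ordConnected T hJ h0J hTJ
  exact ⟨RightPreHilbertModule.isSelfAdjoint_inner_apply hT x,
    (RightPreHilbertModule.spectrum_inner_apply_subset hT hm hM hs hx).trans hmM,
    RightPreHilbertModule.cfc_inner_le hT hm hM hs hmM hf hf0 hx⟩
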